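/- Let $B_0,\dots,B_m\in\mathfrak{so}(n)$ be real antisymmetric $n\times n$ matrices and let $\mathfrak h=\mathrm{Lie}\{B_0,\dots,B_m\}\le\mathfrak{so}(n)$ be the Lie algebra they generate under the commutator. Let $H\le \mathrm{SO}(n)$ be a closed subgroup whose Lie algebra $\{A\in\mathbb R^{n\times n}:\exp(tA)\in H\text{ for all }t\in\mathbb R\}$ equals $\mathfrak h$, and let $x\in\mathbb S^{n-1}\subset\mathbb R^n$, with orbit $H(x)=\{gx: g\in H\}$. Then $H(x)$ is a smooth embedded submanifold, of some dimension $\dim H(x)$, and $$\operatorname{rank}_y\mathfrak h:=\dim\{Ay: A\in\mathfrak h\}=\dim H(x)\qquad\text{for every } y\in H(x).$$ Consequently, let $\mathfrak L=\mathrm{Lie}\{B_0x,\dots,B_mx\}$ be the Lie algebra of vector fields on $\mathbb R^n$ generated by the linear vector fields $x\mapsto B_ix$ (which are tangent to $\mathbb S^{n-1}$) under the Lie bracket of vector fields. Its rank $\dim\{V(y):V\in\mathfrak L\}$ at $y$ is constant for $y\in H(x)$, and equals $\dim H(x)$. -/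

import Mathlib

open scoped ContDiff

-- Matrices form a Lie algebra under the commutator `[C, D] = C D - D C`.
attribute [local instance 100] LieRing.ofAssociativeRing

noncomputable section

namespace OrbitRank

/-- `ℝⁿ` with its Euclidean norm. -/
abbrev E (n : ℕ) : Type := EuclideanSpace ℝ (Fin n)

/-- Real `n × n` matrices. -/
abbrev Mat (n : ℕ) : Type := Matrix (Fin n) (Fin n) ℝ

/-- The evaluation map `A ↦ A y` at a point `y` of `ℝⁿ`. -/
def evalAt {n : ℕ} (y : E n) : Mat n →ₗ[ℝ] E n :=
  LinearMap.applyₗ y ∘ₗ (Matrix.toEuclideanLin (𝕜 := ℝ) (m := Fin n) (n := Fin n)).toLinearMap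

/-- The rank at `y` of a Lie algebra `𝔤` of matrices: `dim {A y : A ∈ 𝔤}`. -/
def rankAt {n : ℕ} (𝔤 : LieSubalgebra ℝ (Mat n)) (y : E n) : ℕ :=
  Module.finrank ℝ (𝔤.toSubmodule.map (evalAt y))

/-- The Lie algebra of a closed subgroup `H` of `SO(n)`, as a set of matrices:
all `A` whose one-parameter group `exp (t A)` lies in `H`. -/
def lieAlgebraOf {n : ℕ} (H : Subgroup (Matrix.specialOrthogonalGroup (Fin n) ℝ)) :
    Set (Mat n) :=
  {A | ∀ t : ℝ, ∃ g ∈ H, (g : Mat n) = NormedSpace.exp (t • A)}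

/-- The orbit `H(x)` for the natural action of `H ≤ SO(n)` on `ℝⁿ`. -/
def orbit {n : ℕ} (H : Subgroup (Matrix.specialOrthogonalGroup (Fin n) ℝ)) (x : E n) :
    Set (E n) :=
  {y | ∃ g ∈ H, Matrix.toEuclideanLin (g : Mat n) x = y}

/-- `S ⊆ ℝⁿ` is a smooth embedded submanifold of dimension `d`: around each of its points there
is a smooth chart of the ambient space (a diffeomorphism between open sets) that flattens `S` to a
`d`-dimensional linear subspace. -/
def IsEmbeddedSubmanifold {n : ℕ} (d : ℕ) (S : Set (E n)) : Prop :=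
  ∀ p ∈ S, ∃ (φ : OpenPartialHomeomorph (E n) (E n)) (W : Submodule ℝ (E n)),
    p ∈ φ.source ∧ ContDiffOn ℝ ∞ φ φ.source ∧ ContDiffOn ℝ ∞ φ.symm φ.target ∧
    Module.finrank ℝ W = d ∧ φ '' (φ.source ∩ S) = φ.target ∩ (W : Set (E n))

/-- The linear vector field `x ↦ B x`. -/
def linearField {n : ℕ} (B : Mat n) : E n → E n :=
  fun x => Matrix.toEuclideanLin B x

/-- The Lie algebra of vector fields on `ℝⁿ` generated by a set `F` of smooth vector fields: the
smallest real vector space of vector fields that contains `F` and is closed under the Lie bracket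
of vector fields. (Smooth fields form such a space, so every member is smooth when `F` is.) -/
def fieldLieSpan {n : ℕ} (F : Set (E n → E n)) : Submodule ℝ (E n → E n) :=
  sInf {L | F ⊆ L ∧ ∀ V ∈ L, ∀ W ∈ L, VectorField.lieBracket ℝ V W ∈ L}

/-- The rank at `y` of a space of vector fields: `dim {V y : V ∈ L}`. -/
def fieldRankAt {n : ℕ} (L : Submodule ℝ (E n → E n)) (y : E n) : ℕ :=
  Module.finrank ℝ (L.map (LinearMap.proj (R := ℝ) (φ := fun _ : E n => E n) y))

end OrbitRank

end

namespace OrbitRank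

/-! ### Conjugation by `H` and constancy of the rank -/

section Algebra

variable {n : ℕ}

/-! For `g ∈ H`, conjugation by `g` preserves `𝔥`, and `A (g x) = g (g⁻¹ A g x)`; hence the rank is
constant along an orbit. The bracket of linear fields is the linear field of a commutator, so the
generated fields are exactly those of `𝔥` and have the same rank.

For the submanifold claim, choose a linear section `σ` of `A ↦ A x` on `𝔥`. Near `1`, every matrix
is a product of three exponentials: along `σ`, along the part of `𝔥` that kills `x`, and along a
complement of `𝔥`. For elements of `H` the last factor is trivial because `H` is closed
(`eventually_eq_zero_of_exp_mem`), and the second fixes `x`. So `exp (σ t) x` describes the orbit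
locally. Compactness of `H` makes this hold for all orbit points close to `x`, so the orbit is
embedded and not merely immersed. -/

@[simp]
theorem evalAt_apply (y : E n) (A : Mat n) : evalAt y A = Matrix.toEuclideanLin A y := rfl

theorem toEuclideanLin_mul_apply (A C : Mat n) (y : E n) :
    Matrix.toEuclideanLin (A * C) y = Matrix.toEuclideanLin A (Matrix.toEuclideanLin C y) := by
  ext i
  simp [Matrix.toLpLin_apply]

theorem toEuclideanLin_one_apply (y : E n) : Matrix.toEuclideanLin (1 : Mat n) y = y := by
  ext i
  simp

/-- The matrices of the elements of `H`. -/
def matrices (H : Subgroup (Matrix.specialOrthogonalGroup (Fin n) ℝ)) : Set (Mat n) :=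
  Subtype.val '' (H : Set (Matrix.specialOrthogonalGroup (Fin n) ℝ))

variable {H : Subgroup (Matrix.specialOrthogonalGroup (Fin n) ℝ)}

theorem one_mem_matrices : (1 : Mat n) ∈ matrices H := ⟨1, H.one_mem, rfl⟩

theorem mul_mem_matrices {a b : Mat n} (ha : a ∈ matrices H) (hb : b ∈ matrices H) :
    a * b ∈ matrices H := by
  obtain ⟨g, hg, rfl⟩ := ha
  obtain ⟨k, hk, rfl⟩ := hb
  exact ⟨g * k, H.mul_mem hg hk, rfl⟩

theorem pow_mem_matrices {a : Mat n} (ha : a ∈ matrices H) (k : ℕ) : a ^ k ∈ matrices H := by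
  induction k with
  | zero => simpa using one_mem_matrices
  | succ k ih => rw [pow_succ]; exact mul_mem_matrices ih ha

theorem exists_inv_mem_matrices {a : Mat n} (ha : a ∈ matrices H) :
    ∃ b ∈ matrices H, a * b = 1 ∧ b * a = 1 := by
  obtain ⟨g, hg, rfl⟩ := ha
  refine ⟨_, ⟨g⁻¹, H.inv_mem hg, rfl⟩, ?_, ?_⟩
  · exact congrArg Subtype.val (mul_inv_cancel g)
  · exact congrArg Subtype.val (inv_mul_cancel g)

theorem mem_lieAlgebraOf {A : Mat n} :
    A ∈ lieAlgebraOf H ↔ ∀ t : ℝ, NormedSpace.exp (t • A) ∈ matrices H := Iff.rfl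

theorem exp_mem_matrices {A : Mat n} (hA : A ∈ lieAlgebraOf H) :
    NormedSpace.exp A ∈ matrices H := by
  simpa using mem_lieAlgebraOf.1 hA 1

theorem mem_orbit {x y : E n} :
    y ∈ orbit H x ↔ ∃ a ∈ matrices H, Matrix.toEuclideanLin a x = y := by
  simp [orbit, matrices]

/-- The Lie algebra of `H` is invariant under conjugation by elements of `H`. -/
theorem conj_mem_lieAlgebraOf {a b A : Mat n} (ha : a ∈ matrices H) (hb : b ∈ matrices H)
    (hab : a * b = 1) (hba : b * a = 1) (hA : A ∈ lieAlgebraOf H) :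
    a * A * b ∈ lieAlgebraOf H := by
  rw [mem_lieAlgebraOf] at hA ⊢
  intro t
  have := Matrix.exp_units_conj (⟨a, b, hab, hba⟩ : (Mat n)ˣ) (t • A)
  simp only [Units.inv_mk] at this
  rw [show t • (a * A * b) = a * (t • A) * b by simp, this]
  exact mul_mem_matrices (mul_mem_matrices ha (hA t)) hb

/-- An invertible matrix normalizing `𝔤` does not change the rank of `𝔤`. -/
theorem rankAt_le_of_conj {𝔤 : LieSubalgebra ℝ (Mat n)} {a b : Mat n} (hba : b * a = 1)
    (h : ∀ A ∈ 𝔤, b * A * a ∈ 𝔤) (y : E n) :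
    rankAt 𝔤 (Matrix.toEuclideanLin a y) ≤ rankAt 𝔤 y := by
  have hab : a * b = 1 := mul_eq_one_comm.1 hba
  have : 𝔤.toSubmodule.map (evalAt (Matrix.toEuclideanLin a y)) ≤
      (𝔤.toSubmodule.map (evalAt y)).map (Matrix.toEuclideanLin a) := by
    rintro _ ⟨A, hA, rfl⟩
    -- `A (a y) = a ((b A a) y)`, since `a b = 1`.
    refine ⟨_, ⟨_, h A hA, rfl⟩, ?_⟩
    rw [evalAt_apply, evalAt_apply, ← toEuclideanLin_mul_apply, ← toEuclideanLin_mul_apply,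
      ← mul_assoc, ← mul_assoc, hab, one_mul]
  exact (Submodule.finrank_mono this).trans (Submodule.finrank_map_le _ _)

theorem rankAt_eq_of_mem_orbit {𝔥 : LieSubalgebra ℝ (Mat n)}
    (hH : lieAlgebraOf H = (𝔥 : Set (Mat n))) {x y : E n} (hy : y ∈ orbit H x) :
    rankAt 𝔥 y = rankAt 𝔥 x := by
  obtain ⟨a, ha, rfl⟩ := mem_orbit.1 hy
  obtain ⟨b, hb, hab, hba⟩ := exists_inv_mem_matrices ha
  have hmem : ∀ A, A ∈ 𝔥 ↔ A ∈ lieAlgebraOf H := fun A => by rw [hH]; rfl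
  refine le_antisymm (rankAt_le_of_conj hba (fun A hA => ?_) x) ?_
  · rw [hmem] at hA ⊢
    exact conj_mem_lieAlgebraOf hb ha hba hab hA
  · have := rankAt_le_of_conj (𝔤 := 𝔥) hab (fun A hA => ?_) (Matrix.toEuclideanLin a x)
    · rwa [← toEuclideanLin_mul_apply, hba, toEuclideanLin_one_apply] at this
    · rw [hmem] at hA ⊢
      exact conj_mem_lieAlgebraOf ha hb hab hba hA

end Algebra

/-! ### Linear vector fields and their brackets -/

section Fields

variable {n : ℕ}

/-- Matrices as linear vector fields. -/
noncomputable def linearFieldMap (n : ℕ) : Mat n →ₗ[ℝ] (E n → E n) where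
  toFun := linearField
  map_add' A C := by ext y; simp [linearField]
  map_smul' c A := by ext y; simp [linearField]

/-- The order flips because `[V, W] = DW·V - DV·W`, which is `C A y - A C y` here. -/
theorem lieBracket_linearField (A C : Mat n) :
    VectorField.lieBracket ℝ (linearField A) (linearField C) = linearField ⁅C, A⁆ := by
  have hd : ∀ (D : Mat n) (y : E n), fderiv ℝ (linearField D) y =
      LinearMap.toContinuousLinearMap (Matrix.toEuclideanLin D) := fun D y =>
    (LinearMap.toContinuousLinearMap (Matrix.toEuclideanLin D)).fderiv
  funext y
  rw [VectorField.lieBracket_eq]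
  simp only [hd]
  simp only [linearField, LinearMap.coe_toContinuousLinearMap', Ring.lie_def, map_sub,
    LinearMap.sub_apply, toEuclideanLin_mul_apply]

/-- The Lie algebra generated by linear vector fields consists of the linear vector fields of the
matrix Lie algebra generated by their matrices. -/
theorem fieldLieSpan_linearField {ι : Type*} (B : ι → Mat n) :
    fieldLieSpan (Set.range fun i => linearField (B i)) =
      (LieSubalgebra.lieSpan ℝ (Mat n) (Set.range B)).toSubmodule.map (linearFieldMap n) := by
  apply le_antisymm
  · refine sInf_le ⟨?_, ?_⟩
    · rintro _ ⟨i, rfl⟩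
      exact ⟨B i, LieSubalgebra.subset_lieSpan ⟨i, rfl⟩, rfl⟩
    · rintro _ ⟨A, hA, rfl⟩ _ ⟨C, hC, rfl⟩
      exact ⟨⁅C, A⁆, LieSubalgebra.lie_mem _ hC hA, (lieBracket_linearField A C).symm⟩
  · refine le_sInf ?_
    rintro L ⟨hF, hL⟩
    let K : LieSubalgebra ℝ (Mat n) :=
      { L.comap (linearFieldMap n) with
        lie_mem' := fun {A C} hA hC => by
          change linearField ⁅A, C⁆ ∈ L
          rw [← lieBracket_linearField]
          exact hL _ hC _ hA }
    have hK : LieSubalgebra.lieSpan ℝ (Mat n) (Set.range B) ≤ K := by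
      rw [LieSubalgebra.lieSpan_le]
      rintro _ ⟨i, rfl⟩
      exact hF ⟨i, rfl⟩
    rintro _ ⟨A, hA, rfl⟩
    exact hK hA

theorem fieldRankAt_linearField {ι : Type*} (B : ι → Mat n) (y : E n) :
    fieldRankAt (fieldLieSpan (Set.range fun i => linearField (B i))) y =
      rankAt (LieSubalgebra.lieSpan ℝ (Mat n) (Set.range B)) y := by
  rw [fieldLieSpan_linearField, fieldRankAt, rankAt, ← Submodule.map_comp]
  rfl

end Fields

/-! ### One-parameter groups in a closed subgroup -/

section Analysis

open Filter Topology
open scoped Matrix.Norms.Operator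

variable {n : ℕ} {H : Subgroup (Matrix.specialOrthogonalGroup (Fin n) ℝ)}

theorem isClosed_specialOrthogonalGroup (n : ℕ) :
    IsClosed (Matrix.specialOrthogonalGroup (Fin n) ℝ : Set (Mat n)) := by
  have : (Matrix.specialOrthogonalGroup (Fin n) ℝ : Set (Mat n)) =
      {A | A * star A = 1} ∩ {A | A.det = 1} := by
    ext A
    exact Matrix.mem_specialOrthogonalGroup_iff.trans
      (and_congr_left fun _ => Matrix.mem_orthogonalGroup_iff (Fin n) ℝ)
  rw [this]
  refine (isClosed_eq ?_ continuous_const).inter (isClosed_eq ?_ continuous_const)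
  · exact continuous_id.mul continuous_star
  · exact continuous_id.matrix_det

theorem isCompact_matrices
    (hH : IsClosed (H : Set (Matrix.specialOrthogonalGroup (Fin n) ℝ))) :
    IsCompact (matrices H) := by
  have hc : IsClosed (matrices H) :=
    (isClosed_specialOrthogonalGroup n).isClosedEmbedding_subtypeVal.isClosedMap _ hH
  have hK : IsCompact (Set.univ.pi fun _ : Fin n => Set.univ.pi fun _ : Fin n =>
      Metric.closedBall (0 : ℝ) 1) :=
    isCompact_univ_pi fun _ => isCompact_univ_pi fun _ => isCompact_closedBall _ _
  refine IsCompact.of_isClosed_subset hK hc ?_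
  rintro _ ⟨g, -, rfl⟩ i - j -
  simpa using entry_norm_bound_of_unitary (𝕜 := ℝ)
    (Matrix.mem_specialOrthogonalGroup_iff.1 g.2).1 i j

/-- If `exp (m k)` lies in the closed group `H`, `m k → 0` and the directions `m k / ‖m k‖` converge
to `M`, then `M` lies in the Lie algebra of `H`. -/
theorem mem_lieAlgebraOf_of_tendsto (hH : IsClosed (matrices H)) {m : ℕ → Mat n} {M : Mat n}
    (hm : ∀ k, NormedSpace.exp (m k) ∈ matrices H) (hm_ne : ∀ k, m k ≠ 0)
    (hm_lim : Tendsto m atTop (𝓝 0))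
    (hM : Tendsto (fun k => ‖m k‖⁻¹ • m k) atTop (𝓝 M)) : M ∈ lieAlgebraOf H := by
  have key : ∀ t : ℝ, 0 ≤ t → NormedSpace.exp (t • M) ∈ matrices H := by
    intro t ht
    have hpos : ∀ k, 0 < ‖m k‖ := fun k => norm_pos_iff.2 (hm_ne k)
    have hnorm : Tendsto (fun k => ‖m k‖) atTop (𝓝 0) := by simpa using hm_lim.norm
    -- Powers of `exp (m k)` stay in `H`; the exponent `⌊t / ‖m k‖⌋₊` makes them converge to `exp (t
    -- • M)`.
    have hfloor : Tendsto (fun k => (⌊t / ‖m k‖⌋₊ : ℝ) * ‖m k‖) atTop (𝓝 t) := by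
      refine tendsto_of_tendsto_of_tendsto_of_le_of_le
        (g := fun k => t - ‖m k‖) (h := fun _ => t) (by simpa using hnorm.const_sub t)
        tendsto_const_nhds (fun k => ?_) (fun k => ?_)
      · have h1 := (Nat.lt_floor_add_one (t / ‖m k‖)).le
        rw [div_le_iff₀ (hpos k)] at h1
        change t - ‖m k‖ ≤ _
        linarith
      · have h1 := Nat.floor_le (div_nonneg ht (hpos k).le)
        rwa [le_div_iff₀ (hpos k)] at h1
    have hlim := (NormedSpace.exp_continuous.tendsto (t • M)).comp (hfloor.smul hM)
    refine hH.mem_of_tendsto hlim (Eventually.of_forall fun k => ?_)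
    have : ((⌊t / ‖m k‖⌋₊ : ℝ) * ‖m k‖) • ‖m k‖⁻¹ • m k = ⌊t / ‖m k‖⌋₊ • m k := by
      rw [smul_smul, mul_assoc, mul_inv_cancel₀ (hpos k).ne', mul_one, Nat.cast_smul_eq_nsmul]
    have hpow := pow_mem_matrices (hm k) ⌊t / ‖m k‖⌋₊
    rw [← Matrix.exp_nsmul] at hpow
    rw [Function.comp_apply, this]
    exact hpow
  rw [mem_lieAlgebraOf]
  intro t
  rcases le_total 0 t with ht | ht
  · exact key t ht
  · obtain ⟨b, hb, hab, -⟩ := exists_inv_mem_matrices (key (-t) (neg_nonneg.2 ht))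
    have : NormedSpace.exp (t • M) = b := by
      rw [← Matrix.inv_eq_right_inv hab, ← Matrix.exp_neg, neg_smul, neg_neg]
    rwa [this]

/-- In a complement of the Lie algebra of `H`, small nonzero matrices do not exponentiate
into `H`. -/
theorem eventually_eq_zero_of_exp_mem (hH : IsClosed (matrices H)) (S : Submodule ℝ (Mat n))
    (hS : ∀ A ∈ S, A ∈ lieAlgebraOf H → A = 0) :
    ∀ᶠ A in 𝓝 (0 : Mat n), A ∈ S → NormedSpace.exp A ∈ matrices H → A = 0 := by
  have : FirstCountableTopology (Mat n) :=
    inferInstanceAs (FirstCountableTopology (Fin n → Fin n → ℝ))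
  by_contra hcon
  have hfr : ∃ᶠ A in 𝓝 (0 : Mat n), A ∈ S ∧ NormedSpace.exp A ∈ matrices H ∧ A ≠ 0 := by
    refine (not_eventually.1 hcon).mono fun A hA => ?_
    push Not at hA
    exact hA
  obtain ⟨m, hm_lim, hm⟩ := exists_seq_forall_of_frequently hfr
  have hsph : ∀ k, ‖m k‖⁻¹ • m k ∈ Metric.sphere (0 : Mat n) 1 := fun k => by
    rw [mem_sphere_zero_iff_norm, norm_smul, norm_inv, norm_norm,
      inv_mul_cancel₀ (norm_ne_zero_iff.2 (hm k).2.2)]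
  obtain ⟨M, hM, φ, hφ, hlim⟩ := (isCompact_sphere (0 : Mat n) 1).tendsto_subseq hsph
  have hMS : M ∈ S := S.closed_of_finiteDimensional.mem_of_tendsto hlim
    (Eventually.of_forall fun k => S.smul_mem _ (hm (φ k)).1)
  have hMH : M ∈ lieAlgebraOf H := mem_lieAlgebraOf_of_tendsto hH (m := m ∘ φ)
    (fun k => (hm (φ k)).2.1) (fun k => (hm (φ k)).2.2) (hm_lim.comp hφ.tendsto_atTop) hlim
  rw [mem_sphere_zero_iff_norm, hS M hMS hMH, norm_zero] at hM
  exact zero_ne_one hM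

end Analysis

/-! ### Exponential coordinates adapted to `H` and to the stabilizer of `x` -/

section Submanifold

open Filter Topology
open scoped Matrix.Norms.Operator

variable {n : ℕ} {H : Subgroup (Matrix.specialOrthogonalGroup (Fin n) ℝ)}

/-- A linear section, extended to the whole space, of a linear map restricted to a submodule. -/
theorem exists_linear_section {V W : Type*} [AddCommGroup V] [Module ℝ V]
    [AddCommGroup W] [Module ℝ W] (f : V →ₗ[ℝ] W) (S : Submodule ℝ V) :
    ∃ σ : W →ₗ[ℝ] V, (∀ w, σ w ∈ S) ∧ ∀ w ∈ S.map f, f (σ w) = w := by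
  obtain ⟨p, hp⟩ := (S.map f).subtype.exists_leftInverse_of_injective
    (LinearMap.ker_eq_bot.2 (S.map f).injective_subtype)
  obtain ⟨g, hg⟩ := (f.submoduleMap S).exists_rightInverse_of_surjective
    (LinearMap.range_eq_top.2 (f.submoduleMap_surjective S))
  refine ⟨S.subtype ∘ₗ g ∘ₗ p, fun w => (g (p w)).2, fun w hw => ?_⟩
  have h1 : p w = ⟨w, hw⟩ := LinearMap.congr_fun hp ⟨w, hw⟩
  have h2 := congrArg Subtype.val (LinearMap.congr_fun hg ⟨w, hw⟩)
  simpa [h1] using h2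

/-- Exponential coordinates of the second kind, for three complementary projections, map
neighbourhoods of `0` to neighbourhoods of `1`. -/
theorem map_exp_mul_exp_mul_exp_nhds_zero {𝔸 : Type*} [NormedRing 𝔸] [NormedAlgebra ℝ 𝔸]
    [CompleteSpace 𝔸] (L₁ L₂ L₃ : 𝔸 →L[ℝ] 𝔸) (h : ∀ A, L₁ A + L₂ A + L₃ A = A) :
    map (fun A => NormedSpace.exp (L₁ A) * NormedSpace.exp (L₂ A) * NormedSpace.exp (L₃ A))
      (𝓝 0) = 𝓝 1 := by
  have key : ∀ L : 𝔸 →L[ℝ] 𝔸,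
      HasStrictFDerivAt (fun A => NormedSpace.exp (L A)) L 0 := fun L => by
    have h0 : HasStrictFDerivAt (NormedSpace.exp : 𝔸 → 𝔸) (1 : 𝔸 →L[ℝ] 𝔸) (L 0) := by
      rw [map_zero]; exact hasStrictFDerivAt_exp_zero
    exact h0.comp 0 L.hasStrictFDerivAt
  have hderiv := (((key L₁).mul' (key L₂)).mul' (key L₃)).congr_fderiv
    (g' := (ContinuousLinearEquiv.refl ℝ 𝔸 : 𝔸 →L[ℝ] 𝔸)) (by
      ext1 A
      simp only [Pi.mul_apply, map_zero, NormedSpace.exp_zero, mul_one, one_smul,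
        MulOpposite.op_one, add_apply, ContinuousLinearEquiv.coe_coe,
        ContinuousLinearEquiv.refl_apply]
      nth_rewrite 4 [← h A]
      abel)
  have hmap := HasStrictFDerivAt.map_nhds_eq_of_equiv hderiv
  simp only [Pi.mul_apply, map_zero, NormedSpace.exp_zero, mul_one] at hmap
  exact hmap

/-- Only the constant term of the exponential series survives at `x`. -/
theorem exp_apply_eq_self_of_apply_eq_zero {A : Mat n} {x : E n} (h : evalAt x A = 0) :
    Matrix.toEuclideanLin (NormedSpace.exp A) x = x := by
  have hs := (NormedSpace.exp_series_hasSum_exp' (𝕂 := ℝ) A).mapL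
    (LinearMap.toContinuousLinearMap (evalAt x))
  refine hs.unique ?_
  have h0 : LinearMap.toContinuousLinearMap (evalAt x)
      (((Nat.factorial 0 : ℕ) : ℝ)⁻¹ • A ^ 0) = x := by
    rw [Nat.factorial_zero, Nat.cast_one, inv_one, one_smul, pow_zero]
    exact toEuclideanLin_one_apply x
  have h1 := hasSum_single (f := fun k : ℕ => LinearMap.toContinuousLinearMap (evalAt x)
    ((k.factorial : ℝ)⁻¹ • A ^ k)) 0 fun k hk => by
      obtain ⟨j, rfl⟩ := Nat.exists_eq_succ_of_ne_zero hk
      rw [LinearMap.coe_toContinuousLinearMap', map_smul, evalAt_apply, pow_succ,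
        toEuclideanLin_mul_apply, ← evalAt_apply x A, h, map_zero, smul_zero]
  rwa [h0] at h1

/-- Elements of `H` near `1` move `x` along the exponentials of a section `σ` of the evaluation
at `x`. -/
theorem eventually_smul_eq_exp_section (hH : IsClosed (matrices H)) {𝔥 : Submodule ℝ (Mat n)}
    (h𝔥 : lieAlgebraOf H = (𝔥 : Set (Mat n))) {x : E n} (σ : E n →ₗ[ℝ] Mat n)
    (hσ : ∀ w, σ w ∈ 𝔥) (hσx : ∀ w ∈ 𝔥.map (evalAt x), evalAt x (σ w) = w)
    {U : Set (E n)} (hU : U ∈ 𝓝 0) :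
    ∀ᶠ a in 𝓝 (1 : Mat n), a ∈ matrices H → ∃ t ∈ U, t ∈ 𝔥.map (evalAt x) ∧
      Matrix.toEuclideanLin a x = Matrix.toEuclideanLin (NormedSpace.exp (σ t)) x := by
  have hmem : ∀ A, A ∈ 𝔥 ↔ A ∈ lieAlgebraOf H := fun A => by rw [h𝔥]; rfl
  -- A section of the identity over `𝔥` is a projection onto `𝔥`; its kernel is the complement used
  -- below.
  obtain ⟨q, hq, hq'⟩ := exists_linear_section (LinearMap.id : Mat n →ₗ[ℝ] Mat n) 𝔥
  simp only [Submodule.map_id, LinearMap.id_apply] at hq'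
  let Q : Mat n →L[ℝ] Mat n := LinearMap.toContinuousLinearMap q
  let τ : Mat n →L[ℝ] E n := LinearMap.toContinuousLinearMap (evalAt x ∘ₗ q)
  let P : Mat n →L[ℝ] Mat n := LinearMap.toContinuousLinearMap (σ ∘ₗ evalAt x ∘ₗ q)
  let R : Mat n →L[ℝ] Mat n := ContinuousLinearMap.id ℝ (Mat n) - Q
  have hmap : map (fun A => NormedSpace.exp (P A) * NormedSpace.exp ((Q - P) A) *
      NormedSpace.exp (R A)) (𝓝 0) = 𝓝 (1 : Mat n) :=
    map_exp_mul_exp_mul_exp_nhds_zero P (Q - P) R fun A => by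
      change P A + (Q A - P A) + (A - Q A) = A
      abel
  rw [← hmap, eventually_map]
  have hR : Tendsto R (𝓝 0) (𝓝 0) := by simpa using R.continuous.tendsto 0
  have hτ : Tendsto τ (𝓝 0) (𝓝 0) := by simpa using τ.continuous.tendsto 0
  have hS := eventually_eq_zero_of_exp_mem hH (LinearMap.ker q) (fun A hA hA' => by
    rw [← hq' A ((hmem A).2 hA')]; exact hA)
  filter_upwards [hR.eventually hS, hτ.eventually hU] with A hA hτA ha
  have hP : P A ∈ lieAlgebraOf H := (hmem _).1 (hσ _)
  have hQP : Q A - P A ∈ lieAlgebraOf H := (hmem _).1 (𝔥.sub_mem (hq _) (hσ _))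
  have hτmem : τ A ∈ 𝔥.map (evalAt x) := ⟨q A, hq A, rfl⟩
  have hRker : R A ∈ LinearMap.ker q := by
    rw [LinearMap.mem_ker]
    change q (A - q A) = 0
    rw [map_sub, hq' _ (hq A), sub_self]
  -- The first two factors lie in `H`, so they can be divided out of the product.
  have hRexp : NormedSpace.exp (R A) ∈ matrices H := by
    have h1 := mul_mem_matrices (exp_mem_matrices hP) (exp_mem_matrices hQP)
    obtain ⟨b, hb, -, hb'⟩ := exists_inv_mem_matrices h1
    have h2 := mul_mem_matrices hb ha
    rwa [sub_apply, ← mul_assoc, hb', one_mul] at h2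
  have hker : evalAt x (Q A - P A) = 0 := by
    rw [map_sub, sub_eq_zero]
    exact (hσx _ hτmem).symm
  refine ⟨τ A, hτA, hτmem, ?_⟩
  rw [hA hRker hRexp, NormedSpace.exp_zero, mul_one, toEuclideanLin_mul_apply,
    sub_apply, exp_apply_eq_self_of_apply_eq_zero hker]
  rfl

end Submanifold

/-! ### Slice charts flattening the orbit -/

section Charts

open Filter Topology
open scoped Matrix.Norms.Operator

variable {n : ℕ} {H : Subgroup (Matrix.specialOrthogonalGroup (Fin n) ℝ)}

/-- Near `x`, the orbit of `x` consists of the points `exp (σ t) x` with `t` small and tangent. -/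
theorem eventually_mem_orbit_eq_exp_section (hH : IsCompact (matrices H))
    {𝔥 : Submodule ℝ (Mat n)} (h𝔥 : lieAlgebraOf H = (𝔥 : Set (Mat n))) {x : E n}
    (σ : E n →ₗ[ℝ] Mat n) (hσ : ∀ w, σ w ∈ 𝔥)
    (hσx : ∀ w ∈ 𝔥.map (evalAt x), evalAt x (σ w) = w) {U : Set (E n)} (hU : U ∈ 𝓝 0) :
    ∀ᶠ y in 𝓝 x, y ∈ orbit H x → ∃ t ∈ U, t ∈ 𝔥.map (evalAt x) ∧
      y = Matrix.toEuclideanLin (NormedSpace.exp (σ t)) x := by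
  obtain ⟨O, hO, hO_open, hO_one⟩ := eventually_nhds_iff.1
    (eventually_smul_eq_exp_section hH.isClosed h𝔥 σ hσ hσx hU)
  -- Elements of `H` that no right multiplication by a stabilizer element brings into `O`. The image
  -- of this compact set is closed and misses `x`.
  let C : Set (Mat n) :=
    matrices H ∩ ⋂ s ∈ {s ∈ matrices H | Matrix.toEuclideanLin s x = x}, (fun a => a * s) ⁻¹' Oᶜ
  have hC : IsCompact C := by
    refine hH.inter_right (isClosed_biInter fun s _ => ?_)
    exact hO_open.isClosed_compl.preimage (continuous_id.mul continuous_const)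
  have hev : Continuous fun a : Mat n => evalAt x a :=
    LinearMap.continuous_of_finiteDimensional _
  have hxC : x ∈ ((fun a : Mat n => evalAt x a) '' C)ᶜ := by
    rintro ⟨a, ⟨ha, haC⟩, hax⟩
    replace hax : Matrix.toEuclideanLin a x = x := hax
    obtain ⟨b, hb, hab, hba⟩ := exists_inv_mem_matrices ha
    have hbx : Matrix.toEuclideanLin b x = x := by
      conv_lhs => rw [← hax]
      rw [← toEuclideanLin_mul_apply, hba, toEuclideanLin_one_apply]
    refine Set.mem_iInter₂.1 haC b ⟨hb, hbx⟩ ?_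
    change a * b ∈ O
    rwa [hab]
  filter_upwards [(hC.image hev).isClosed.isOpen_compl.mem_nhds hxC] with y hy hyx
  obtain ⟨a, ha, rfl⟩ := mem_orbit.1 hyx
  have haC : a ∉ C := fun h => hy ⟨a, h, rfl⟩
  have : ∃ s ∈ matrices H, Matrix.toEuclideanLin s x = x ∧ a * s ∈ O := by
    by_contra hcon
    push Not at hcon
    exact haC ⟨ha, Set.mem_iInter₂.2 fun s hs => hcon s hs.1 hs.2⟩
  obtain ⟨s, hs, hsx, hsO⟩ := this
  obtain ⟨t, htU, ht, hteq⟩ := hO _ hsO (mul_mem_matrices ha hs)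
  rw [toEuclideanLin_mul_apply, hsx] at hteq
  exact ⟨t, htU, ht, hteq⟩

/-- The exponential of a section of the evaluation at `x`, completed by a linear map in the
transverse directions to a local diffeomorphism at the origin. -/
noncomputable def slice (x : E n) (σ : E n →ₗ[ℝ] Mat n) (w : E n) : E n :=
  evalAt x (NormedSpace.exp (σ w)) + (w - evalAt x (σ w))

theorem slice_zero (x : E n) (σ : E n →ₗ[ℝ] Mat n) : slice x σ 0 = x := by
  rw [slice, map_zero, NormedSpace.exp_zero, evalAt_apply, toEuclideanLin_one_apply, map_zero,
    sub_zero, add_zero]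

theorem contDiff_slice (x : E n) (σ : E n →ₗ[ℝ] Mat n) : ContDiff ℝ ω (slice x σ) := by
  have hexp : ContDiff ℝ ω (NormedSpace.exp : Mat n → Mat n) :=
    contDiff_iff_contDiffAt.2 fun A => (NormedSpace.exp_analytic (𝕂 := ℝ) A).contDiffAt
  have hσ : ContDiff ℝ ω σ := (LinearMap.toContinuousLinearMap σ).contDiff
  have hev : ContDiff ℝ ω (evalAt x) := (LinearMap.toContinuousLinearMap (evalAt x)).contDiff
  exact (hev.comp (hexp.comp hσ)).add (contDiff_id.sub (hev.comp hσ))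

/-- The exponential term contributes `evalAt x ∘ σ`, which the correction term cancels, leaving the
identity. -/
theorem hasFDerivAt_slice (x : E n) (σ : E n →ₗ[ℝ] Mat n) :
    HasFDerivAt (slice x σ) (ContinuousLinearMap.id ℝ (E n)) 0 := by
  let σ' := LinearMap.toContinuousLinearMap σ
  let ev := LinearMap.toContinuousLinearMap (evalAt x)
  have h0 : HasFDerivAt (NormedSpace.exp : Mat n → Mat n) (1 : Mat n →L[ℝ] Mat n) (σ' 0) := by
    rw [map_zero]; exact hasFDerivAt_exp_zero
  have h1 := (ev.hasFDerivAt.comp 0 (h0.comp 0 σ'.hasFDerivAt)).add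
    ((hasFDerivAt_id (𝕜 := ℝ) (0 : E n)).sub (ev.hasFDerivAt.comp 0 σ'.hasFDerivAt))
  refine h1.congr_fderiv ?_
  ext1 w
  exact add_sub_cancel (ev (σ' w)) w

theorem orbit_eq_of_mem {x p : E n} (hp : p ∈ orbit H x) : orbit H p = orbit H x := by
  obtain ⟨a, ha, rfl⟩ := mem_orbit.1 hp
  obtain ⟨b, hb, -, hba⟩ := exists_inv_mem_matrices ha
  ext y
  simp only [mem_orbit]
  constructor
  · rintro ⟨c, hc, rfl⟩
    exact ⟨c * a, mul_mem_matrices hc ha, toEuclideanLin_mul_apply _ _ _⟩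
  · rintro ⟨c, hc, rfl⟩
    refine ⟨c * b, mul_mem_matrices hc hb, ?_⟩
    rw [← toEuclideanLin_mul_apply, mul_assoc, hba, mul_one]

/-- A smooth chart at `x` that flattens the orbit of `x` to its tangent space `𝔥 x`. -/
theorem exists_chart_orbit (hH : IsCompact (matrices H)) {𝔥 : Submodule ℝ (Mat n)}
    (h𝔥 : lieAlgebraOf H = (𝔥 : Set (Mat n))) (x : E n) :
    ∃ φ : OpenPartialHomeomorph (E n) (E n), x ∈ φ.source ∧ ContDiffOn ℝ ∞ φ φ.source ∧
      ContDiffOn ℝ ∞ φ.symm φ.target ∧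
      φ '' (φ.source ∩ orbit H x) = φ.target ∩ (𝔥.map (evalAt x) : Set (E n)) := by
  obtain ⟨σ, hσ, hσx⟩ := exists_linear_section (evalAt x) 𝔥
  have hslice : ∀ t ∈ 𝔥.map (evalAt x),
      slice x σ t = Matrix.toEuclideanLin (NormedSpace.exp (σ t)) x := fun t ht => by
    rw [slice, hσx t ht, sub_self, add_zero, evalAt_apply]
  have hcd := (contDiff_slice x σ).contDiffAt (x := 0)
  have hd : HasFDerivAt (slice x σ) (ContinuousLinearEquiv.refl ℝ (E n) : E n →L[ℝ] E n) 0 :=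
    hasFDerivAt_slice x σ
  have hω : (ω : ℕ∞ω) ≠ 0 := by simp
  let e := hcd.toOpenPartialHomeomorph (slice x σ) hd hω
  have he : ∀ w, e w = slice x σ w := fun _ => rfl
  have h0 : (0 : E n) ∈ e.source := hcd.mem_toOpenPartialHomeomorph_source hd hω
  have hxt : x ∈ e.target := by
    have := hcd.image_mem_toOpenPartialHomeomorph_target hd hω
    rwa [slice_zero] at this
  have hsymm : ContDiffAt ℝ ω e.symm x := by
    have := hcd.to_localInverse hd hω
    rwa [slice_zero] at this
  -- Taking `e.source` as the neighbourhood of `0` puts the parameter `t` of an orbit point where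
  -- `e.symm` inverts `e`.
  obtain ⟨V, hV, hV_open, hxV⟩ := eventually_nhds_iff.1
    ((hsymm.eventually (by simp)).and
      (eventually_mem_orbit_eq_exp_section hH h𝔥 σ hσ hσx (e.open_source.mem_nhds h0)))
  refine ⟨e.symm.restrOpen V hV_open, ⟨hxt, hxV⟩, ?_, ?_, ?_⟩
  · intro y hy
    exact ((hV y hy.2).1.of_le le_top).contDiffWithinAt
  · exact ((contDiff_slice x σ).of_le le_top).contDiffOn
  · ext w
    constructor
    · rintro ⟨y, ⟨hy, hyx⟩, rfl⟩
      refine ⟨(e.symm.restrOpen V hV_open).map_source hy, ?_⟩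
      obtain ⟨t, ht, htT, rfl⟩ := (hV y hy.2).2 hyx
      rw [← hslice t htT, ← he]
      change e.symm (e t) ∈ _
      rw [e.left_inv ht]
      exact htT
    · rintro ⟨hw, hwT⟩
      refine ⟨slice x σ w, ⟨(e.symm.restrOpen V hV_open).map_target hw, ?_⟩,
        (e.symm.restrOpen V hV_open).right_inv hw⟩
      rw [hslice w hwT, mem_orbit]
      refine ⟨_, exp_mem_matrices ?_, rfl⟩
      rw [h𝔥]
      exact hσ w

end Charts

/-- An orbit of a closed subgroup of `SO(n)` is an embedded submanifold, whose dimension is the rank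
of the Lie algebra at the base point. -/
theorem isEmbeddedSubmanifold_orbit {n : ℕ}
    {H : Subgroup (Matrix.specialOrthogonalGroup (Fin n) ℝ)}
    (hH : IsClosed (H : Set (Matrix.specialOrthogonalGroup (Fin n) ℝ)))
    {𝔥 : LieSubalgebra ℝ (Mat n)} (h𝔥 : lieAlgebraOf H = (𝔥 : Set (Mat n))) (x : E n) :
    IsEmbeddedSubmanifold (rankAt 𝔥 x) (orbit H x) := by
  intro p hp
  obtain ⟨φ, hφ, hφ_smooth, hφ_symm, himage⟩ :=
    exists_chart_orbit (isCompact_matrices hH) (𝔥 := 𝔥.toSubmodule) h𝔥 p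
  rw [orbit_eq_of_mem hp] at himage
  exact ⟨φ, _, hφ, hφ_smooth, hφ_symm, rankAt_eq_of_mem_orbit h𝔥 hp, himage⟩

end OrbitRank

theorem mainTheorem6 (n m : ℕ) (B : Fin (m + 1) → OrbitRank.Mat n)
    (hB : ∀ i, B i ∈ LieAlgebra.Orthogonal.so (Fin n) ℝ)
    (𝔥 : LieSubalgebra ℝ (OrbitRank.Mat n))
    (h𝔥 : 𝔥 = LieSubalgebra.lieSpan ℝ (OrbitRank.Mat n) (Set.range B))
    (H : Subgroup (Matrix.specialOrthogonalGroup (Fin n) ℝ))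
    (hH_closed : IsClosed (H : Set (Matrix.specialOrthogonalGroup (Fin n) ℝ)))
    (hH_lie : OrbitRank.lieAlgebraOf H = (𝔥 : Set (OrbitRank.Mat n)))
    (x : OrbitRank.E n) (hx : x ∈ Metric.sphere (0 : OrbitRank.E n) 1) :
    ∃ d : ℕ, OrbitRank.IsEmbeddedSubmanifold d (OrbitRank.orbit H x) ∧
      (∀ y ∈ OrbitRank.orbit H x, OrbitRank.rankAt 𝔥 y = d) ∧
      (∀ y ∈ OrbitRank.orbit H x,
        OrbitRank.fieldRankAt
          (OrbitRank.fieldLieSpan (Set.range fun i => OrbitRank.linearField (B i))) y = d) := by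
  refine ⟨OrbitRank.rankAt 𝔥 x, OrbitRank.isEmbeddedSubmanifold_orbit hH_closed hH_lie x,
    fun y hy => OrbitRank.rankAt_eq_of_mem_orbit hH_lie hy, fun y hy => ?_⟩
  rw [OrbitRank.fieldRankAt_linearField, ← h𝔥]
  exact OrbitRank.rankAt_eq_of_mem_orbit hH_lie hy
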